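/- Let $n,p,m$ be nonnegative integers, and fix any matrix $D\in\mathbb{R}^{m\times p}$ and any $\lambda>0$. Let $X\in\mathbb{R}^{n\times p}$ be a random matrix and $y\in\mathbb{R}^n$ a random vector whose joint distribution is absolutely continuous with respect to $(np+n)$-dimensional Lebesgue measure. If $p\le n$, or else $p>n$ and $\mathrm{nullity}(D)=\dim\{\beta\in\mathbb{R}^p: D\beta=0\}\le n$, then, almost surely, the generalized lasso problem $$\mathop{\mathrm{minimize}}_{\beta\in\mathbb{R}^p}\ \tfrac12\|y-X\beta\|_2^2+\lambda\|D\beta\|_1$$ has a unique solution, i.e. its criterion has exactly one global minimizer. -/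

import Mathlib

open MeasureTheory
open scoped Matrix

noncomputable section

/-- The generalized lasso criterion `β ↦ (1/2) ‖y - X β‖₂² + lam * ‖D β‖₁` on `ℝᵖ`. -/
def genLassoCriterion {n p m : ℕ} (y : Fin n → ℝ) (X : Matrix (Fin n) (Fin p) ℝ)
    (D : Matrix (Fin m) (Fin p) ℝ) (lam : ℝ) (β : Fin p → ℝ) : ℝ :=
  (1 / 2 : ℝ) * ‖WithLp.toLp 2 (y - X *ᵥ β)‖ ^ 2 + lam * ‖WithLp.toLp 1 (D *ᵥ β)‖

/-- `β` is a solution of the generalized lasso problem: a global minimizer of the criterion. -/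
def IsGenLassoSolution {n p m : ℕ} (y : Fin n → ℝ) (X : Matrix (Fin n) (Fin p) ℝ)
    (D : Matrix (Fin m) (Fin p) ℝ) (lam : ℝ) (β : Fin p → ℝ) : Prop :=
  ∀ β' : Fin p → ℝ, genLassoCriterion y X D lam β ≤ genLassoCriterion y X D lam β'

/-- The dimension of the null space `{β | D β = 0}` of a matrix. -/
def matrixNullity {m p : ℕ} (D : Matrix (Fin m) (Fin p) ℝ) : ℕ :=
  Module.finrank ℝ (LinearMap.ker D.mulVecLin)

end

/-!
By hypothesis `ker D` has dimension at most `n`. The proof uses this only to know that, for almost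
every design matrix `X`, the map `β ↦ X β` is injective on `ker D` (`ae_mulVec_injOn`). Then
`β ↦ (X β, D β)` is injective, so the criterion is coercive and has a minimizer
(`exists_isGenLassoSolution`).

Uniqueness comes from an envelope argument in the data `θ = (X, y)`. The optimal value
`V θ = min_β (½ ‖y - X β‖² + lam ‖D β‖₁)`, with `β` restricted to a ball, is locally Lipschitz in
`θ`, so it is differentiable at almost every `θ` by Rademacher's theorem. For any minimizer `β` the
function `θ' ↦ ½ ‖y' - X' β‖² + lam ‖D β‖₁` lies above `V` and touches it at `θ`, so the two have
the same gradient there (`ae_forall_minimizers_fderiv_eq`). That gradient is `(-r βᵀ, r)` with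
`r = y - X β`. Hence two minimizers `β₁`, `β₂` have the same residual `r` and satisfy
`r β₁ᵀ = r β₂ᵀ`; if `r ≠ 0`, they agree (`residual_eq_and_eq_of_fderiv_eq`). If `r = 0`, comparing
`β` with its multiples `(1 - s) β` shows that both minimizers lie in `ker D`
(`IsGenLassoSolution.mulVec_eq_zero`), where `X` is injective.
-/

/-! ### Envelope principle for a minimum depending on a parameter -/

theorem bddBelow_range_objective {E F : Type*} [TopologicalSpace E] [TopologicalSpace F]
    {G : E × F → ℝ} (hG : Continuous G) {h : E → ℝ} (hh : Continuous h) {K : Set E}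
    (hK : IsCompact K) (θ : F) : BddBelow (Set.range fun β : K => G (β, θ) + h β) := by
  have : CompactSpace K := isCompact_iff_compactSpace.1 hK
  exact (isCompact_range (by fun_prop)).bddBelow

theorem exists_lipschitzOnWith_iInf {E F : Type*} [NormedAddCommGroup E] [NormedSpace ℝ E]
    [NormedAddCommGroup F] [NormedSpace ℝ F] {G : E × F → ℝ} (hG : ContDiff ℝ 1 G) {h : E → ℝ}
    (hh : Continuous h) {K : Set E} (hK : IsCompact K) (hKne : K.Nonempty) {T : Set F}
    (hT : IsCompact T) :
    ∃ C, LipschitzOnWith C (fun θ => ⨅ β : K, G (β, θ) + h β) T := by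
  have : Nonempty K := hKne.to_subtype
  obtain ⟨C, hC⟩ := hG.locallyLipschitz.locallyLipschitzOn.exists_lipschitzOnWith_of_compact
    (hK.prod hT)
  refine ⟨C, LipschitzOnWith.of_le_add_mul C fun θ hθ θ' hθ' => ?_⟩
  rw [← sub_le_iff_le_add]
  refine le_ciInf fun β => ?_
  rw [sub_le_iff_le_add]
  refine (ciInf_le (bddBelow_range_objective hG.continuous hh hK θ) β).trans ?_
  have := hC.le_add_mul (x := ((β : E), θ)) ⟨β.2, hθ⟩ (y := ((β : E), θ')) ⟨β.2, hθ'⟩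
  rw [Prod.dist_eq] at this
  simp only [dist_self, dist_nonneg, sup_of_le_right] at this
  linarith

/-- Envelope principle: for almost every parameter `θ`, all global minimizers `β` of
`β ↦ G (β, θ) + h β` share the same derivative of `G (β, ·)` at `θ`. It is the derivative of the
value function, which exists almost everywhere by Rademacher's theorem. -/
theorem ae_forall_minimizers_fderiv_eq {E F : Type*} [NormedAddCommGroup E] [NormedSpace ℝ E]
    [FiniteDimensional ℝ E] [NormedAddCommGroup F] [NormedSpace ℝ F] [FiniteDimensional ℝ F]
    [MeasurableSpace F] [BorelSpace F] (μ : Measure F) [μ.IsAddHaarMeasure]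
    {G : E × F → ℝ} (hG : ContDiff ℝ 1 G) {h : E → ℝ} (hh : Continuous h) :
    ∀ᵐ θ ∂μ, ∀ β₁ β₂ : E, (∀ β, G (β₁, θ) + h β₁ ≤ G (β, θ) + h β) →
      (∀ β, G (β₂, θ) + h β₂ ≤ G (β, θ) + h β) →
      fderiv ℝ (fun θ' => G (β₁, θ')) θ = fderiv ℝ (fun θ' => G (β₂, θ')) θ := by
  -- The value function is only locally Lipschitz after restricting `β` to a ball, hence the
  -- countable family of radii; `S` localizes the parameter.
  have key : ∀ R S : ℕ, ∀ᵐ θ ∂μ, θ ∈ Metric.closedBall (0 : F) S →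
      DifferentiableWithinAt ℝ (fun θ' => ⨅ β : Metric.closedBall (0 : E) R, G (β, θ') + h β)
        (Metric.closedBall (0 : F) S) θ := fun R S => by
    obtain ⟨C, hC⟩ := exists_lipschitzOnWith_iInf hG hh (isCompact_closedBall (0 : E) (R : ℝ))
      ⟨0, Metric.mem_closedBall_self R.cast_nonneg⟩ (isCompact_closedBall (0 : F) (S : ℝ))
    exact hC.ae_differentiableWithinAt_of_mem
  filter_upwards [ae_all_iff.2 fun R => ae_all_iff.2 (key R)] with θ hθ β₁ β₂ h₁ h₂
  obtain ⟨R, hR⟩ := exists_nat_ge (max ‖β₁‖ ‖β₂‖)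
  obtain ⟨S, hS⟩ := exists_nat_gt ‖θ‖
  set V : F → ℝ := fun θ' => ⨅ β : Metric.closedBall (0 : E) R, G (β, θ') + h β with hV
  have hVd : DifferentiableAt ℝ V θ :=
    (hθ R S (by simpa using hS.le)).differentiableAt
      (Metric.closedBall_mem_nhds_of_mem (by simpa using hS))
  have hbdd := bddBelow_range_objective hG.continuous hh (isCompact_closedBall (0 : E) (R : ℝ))
  suffices H : ∀ b : E, ‖b‖ ≤ R → (∀ β, G (b, θ) + h b ≤ G (β, θ) + h β) →
      fderiv ℝ (fun θ' => G (b, θ')) θ = fderiv ℝ V θ from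
    (H β₁ ((le_max_left _ _).trans hR) h₁).trans (H β₂ ((le_max_right _ _).trans hR) h₂).symm
  intro b hb hmin
  have hbR : b ∈ Metric.closedBall (0 : E) (R : ℝ) := by simpa using hb
  have hGb : DifferentiableAt ℝ (fun θ' => G (b, θ')) θ :=
    ((hG.differentiable one_ne_zero).comp (by fun_prop : Differentiable ℝ fun θ' : F => (b, θ'))) θ
  have hVle : ∀ θ', V θ' ≤ G (b, θ') + h b := fun θ' => ciInf_le (hbdd θ') ⟨b, hbR⟩
  have : Nonempty (Metric.closedBall (0 : E) (R : ℝ)) := ⟨⟨b, hbR⟩⟩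
  have hVeq : G (b, θ) + h b ≤ V θ := le_ciInf fun β => hmin β
  -- `G (b, ·) + h b - V` is nonnegative and vanishes at `θ`.
  have hloc : IsLocalMin (fun θ' => G (b, θ') - V θ') θ :=
    Filter.Eventually.of_forall fun θ' => by
      have := hVle θ'
      change G (b, θ) - V θ ≤ G (b, θ') - V θ'
      linarith
  exact sub_eq_zero.1 (hloc.hasFDerivAt_eq_zero (hGb.hasFDerivAt.sub hVd.hasFDerivAt))

/-! ### Injectivity of a generic matrix on a subspace -/

/-- A generic `n × p` matrix is injective on any fixed subspace of dimension at most `n`. -/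
theorem ae_mulVec_injOn {n p : ℕ} (E : Submodule ℝ (Fin p → ℝ)) (hE : Module.finrank ℝ E ≤ n) :
    ∀ᵐ A : Fin n → Fin p → ℝ, ∀ β ∈ E, Matrix.of A *ᵥ β = 0 → β = 0 := by
  obtain ⟨i, hi⟩ : ∃ i : E →ₗ[ℝ] (Fin n → ℝ), Function.Injective i :=
    finrank_le_iff_exists_linearMap.1 (by simpa using hE)
  obtain ⟨A₁, hA₁⟩ := i.exists_extend
  obtain ⟨L, hL⟩ := i.exists_leftInverse_of_injective (LinearMap.ker_eq_bot.2 hi)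
  -- Restrict a matrix to `E`, then compose with the left inverse `L` of the injection `i`.
  let Φ : (Fin n → Fin p → ℝ) →ₗ[ℝ] (E →ₗ[ℝ] E) :=
    LinearMap.compRight ℝ L ∘ₗ LinearMap.lcomp ℝ (Fin n → ℝ) E.subtype ∘ₗ
      (Matrix.toLin' : Matrix (Fin n) (Fin p) ℝ ≃ₗ[ℝ] _).toLinearMap ∘ₗ
      (Matrix.ofLinearEquiv ℝ).toLinearMap
  have hΦ : ∀ A (β : E), Φ A β = L (Matrix.of A *ᵥ (β : Fin p → ℝ)) := fun A β => by
    simp [Φ]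
  let b := Module.finBasis ℝ E
  have hcont : Continuous fun A => LinearMap.det (Φ A) := by
    simp_rw [← LinearMap.det_toMatrix b]
    exact Continuous.matrix_det
      ((LinearMap.toMatrix b b).toLinearMap ∘ₗ Φ).continuous_of_finiteDimensional
  have hs : MeasurableSet {A | LinearMap.det (Φ A) ≠ 0} :=
    (isOpen_ne_fun hcont continuous_const).measurableSet
  have h₁ : Φ (Matrix.of.symm (LinearMap.toMatrix' A₁)) = LinearMap.id := by
    ext1 β
    rw [hΦ, Equiv.apply_symm_apply, LinearMap.toMatrix'_mulVec, ← hL, ← hA₁]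
    rfl
  -- Along lines in the direction of an extension `A₁` of `i`, `Φ` is translated by multiples of the
  -- identity, so it is singular only at the finitely many negatives of eigenvalues.
  have hae : ∀ᵐ A : Fin n → Fin p → ℝ, A ∈ {A | LinearMap.det (Φ A) ≠ 0} := by
    refine ae_mem_of_ae_add_linearMap_mem
      (LinearMap.toSpanSingleton ℝ _ (Matrix.of.symm (LinearMap.toMatrix' A₁)))
      (volume : Measure ℝ) volume hs fun A => ?_
    have hfin : {t : ℝ | Module.End.HasEigenvalue (Φ A) (-t)}.Finite :=
      (Module.End.finite_hasEigenvalue (Φ A)).preimage neg_injective.injOn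
    filter_upwards [hfin.measure_zero volume |> compl_mem_ae_iff.2] with t ht hdet
    refine ht ?_
    rw [Set.mem_ofPred_eq, Module.End.hasEigenvalue_iff, Module.End.eigenspace_def]
    intro hker
    refine ((LinearMap.isUnit_iff_isUnit_det _).1
      ((LinearMap.isUnit_iff_ker_eq_bot _).2 ?_)).ne_zero hdet
    have heq : Φ A - (-t) • (1 : Module.End ℝ E) = Φ A + t • LinearMap.id := by
      ext1 β
      simp [sub_eq_add_neg]
    rw [LinearMap.toSpanSingleton_apply, map_add, map_smul, h₁, ← heq, hker]
  filter_upwards [hae] with A hA β hβ h0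
  have hu := (LinearMap.isUnit_iff_isUnit_det _).2 (IsUnit.mk0 _ hA)
  have := LinearMap.ker_eq_bot'.1 ((LinearMap.isUnit_iff_ker_eq_bot _).1 hu) ⟨β, hβ⟩
    (by rw [hΦ]; simp [h0])
  simpa using this

/-! ### Existence of solutions and solutions with zero residual -/

theorem exists_isGenLassoSolution {n p m : ℕ} (y : Fin n → ℝ) (X : Matrix (Fin n) (Fin p) ℝ)
    (D : Matrix (Fin m) (Fin p) ℝ) {lam : ℝ} (hlam : 0 < lam)
    (hX : ∀ β ∈ LinearMap.ker D.mulVecLin, X *ᵥ β = 0 → β = 0) :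
    ∃ β, IsGenLassoSolution y X D lam β := by
  let T : (Fin p → ℝ) →ₗ[ℝ] (Fin n → ℝ) × (Fin m → ℝ) := X.mulVecLin.prod D.mulVecLin
  have hT : LinearMap.ker T = ⊥ := LinearMap.ker_eq_bot'.2 fun β hβ =>
    hX β (congrArg Prod.snd hβ) (congrArg Prod.fst hβ)
  have hc : 0 < min 1 lam := lt_min one_pos hlam
  have hlim : Filter.Tendsto
      (fun β => min 1 lam * ‖T β‖ - (‖y‖ + 1 / 2)) (Filter.cocompact _) Filter.atTop :=
    Filter.tendsto_atTop_add_const_right _ _ ((tendsto_norm_cocompact_atTop.comp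
      (LinearMap.isClosedEmbedding_of_injective hT).tendsto_cocompact).const_mul_atTop hc)
  refine Continuous.exists_forall_le (f := genLassoCriterion y X D lam) ?_
    (Filter.tendsto_atTop_mono (fun β => ?_) hlim)
  · unfold genLassoCriterion
    fun_prop
  · have h1 : ‖T β‖ ≤ ‖X *ᵥ β‖ + ‖D *ᵥ β‖ := max_le_add_of_nonneg (norm_nonneg _) (norm_nonneg _)
    have h2 : ‖y - X *ᵥ β‖ ≤ ‖WithLp.toLp 2 (y - X *ᵥ β)‖ :=
      (pi_norm_le_iff_of_nonneg (norm_nonneg _)).2 fun i =>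
        PiLp.norm_apply_le (WithLp.toLp 2 (y - X *ᵥ β)) i
    have h3 : ‖D *ᵥ β‖ ≤ ‖WithLp.toLp 1 (D *ᵥ β)‖ :=
      (pi_norm_le_iff_of_nonneg (norm_nonneg _)).2 fun i =>
        PiLp.norm_apply_le (WithLp.toLp 1 (D *ᵥ β)) i
    have h4 : ‖X *ᵥ β‖ ≤ ‖y‖ + ‖y - X *ᵥ β‖ := by
      rw [norm_sub_rev y]; exact norm_le_norm_add_norm_sub' _ _
    have h5 : min 1 lam * ‖T β‖ ≤ ‖X *ᵥ β‖ + lam * ‖D *ᵥ β‖ :=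
      calc min 1 lam * ‖T β‖ ≤ min 1 lam * (‖X *ᵥ β‖ + ‖D *ᵥ β‖) := by gcongr
        _ = min 1 lam * ‖X *ᵥ β‖ + min 1 lam * ‖D *ᵥ β‖ := mul_add _ _ _
        _ ≤ 1 * ‖X *ᵥ β‖ + lam * ‖D *ᵥ β‖ := by
          gcongr
          exacts [min_le_left _ _, min_le_right _ _]
        _ = _ := by rw [one_mul]
    have h6 : lam * ‖D *ᵥ β‖ ≤ lam * ‖WithLp.toLp 1 (D *ᵥ β)‖ := by gcongr
    simp only [genLassoCriterion]
    nlinarith [sq_nonneg (‖WithLp.toLp 2 (y - X *ᵥ β)‖ - 1)]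

/-- A solution that interpolates the data lies in the null space of `D`: shrinking it by a factor
`1 - s` costs only `O(s²)` in the fit but gains a multiple of `s` in the penalty. -/
theorem IsGenLassoSolution.mulVec_eq_zero {n p m : ℕ} {y : Fin n → ℝ}
    {X : Matrix (Fin n) (Fin p) ℝ} {D : Matrix (Fin m) (Fin p) ℝ} {lam : ℝ} (hlam : 0 < lam)
    {β : Fin p → ℝ} (hβ : IsGenLassoSolution y X D lam β) (hy : y - X *ᵥ β = 0) :
    D *ᵥ β = 0 := by
  have hXβ : X *ᵥ β = y := (sub_eq_zero.1 hy).symm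
  have key : ∀ s : ℝ, 0 < s → s ≤ 1 →
      lam * ‖WithLp.toLp 1 (D *ᵥ β)‖ ≤ s * (1 / 2 * ‖WithLp.toLp 2 y‖ ^ 2) := by
    intro s hs hs1
    have h := hβ ((1 - s) • β)
    have e1 : y - X *ᵥ ((1 - s) • β) = s • y := by
      rw [Matrix.mulVec_smul, hXβ]; module
    simp only [genLassoCriterion, hy, e1] at h
    simp only [Matrix.mulVec_smul, WithLp.toLp_smul, norm_smul, WithLp.toLp_zero, norm_zero, Real.norm_eq_abs, abs_of_pos hs,
      abs_of_nonneg (sub_nonneg.2 hs1)] at h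
    refine le_of_mul_le_mul_left ?_ hs
    linarith
  have hle : lam * ‖WithLp.toLp 1 (D *ᵥ β)‖ ≤ 0 := by
    refine ge_of_tendsto (x := nhdsWithin (0 : ℝ) (Set.Ioi 0))
      (f := fun s : ℝ => s * (1 / 2 * ‖WithLp.toLp 2 y‖ ^ 2)) ?_ ?_
    · refine tendsto_nhdsWithin_of_tendsto_nhds ?_
      exact (by fun_prop : Continuous fun s : ℝ =>
        s * (1 / 2 * ‖WithLp.toLp 2 y‖ ^ 2)).tendsto' 0 0 (zero_mul _)
    · filter_upwards [Ioc_mem_nhdsGT (zero_lt_one' ℝ)] with s hs using key s hs.1 hs.2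
  have h0 : ‖WithLp.toLp 1 (D *ᵥ β)‖ = 0 :=
    le_antisymm (nonpos_of_mul_nonpos_right hle hlam) (norm_nonneg _)
  simpa using h0

/-! ### Derivative of the fit term in the data -/

/-- Half the squared Euclidean norm of `y - X β`, as a function of `(β, (X, y))`. -/
noncomputable def halfSqResidual {n p : ℕ} (z : (Fin p → ℝ) × ((Fin n → Fin p → ℝ) × (Fin n → ℝ))) : ℝ :=
  1 / 2 * ∑ i, (z.2.2 i - ∑ j, z.2.1 i j * z.1 j) ^ 2

theorem contDiff_halfSqResidual {n p : ℕ} : ContDiff ℝ 1 (halfSqResidual (n := n) (p := p)) := by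
  unfold halfSqResidual
  fun_prop

theorem genLassoCriterion_eq {n p m : ℕ} (θ : (Fin n → Fin p → ℝ) × (Fin n → ℝ))
    (D : Matrix (Fin m) (Fin p) ℝ) (lam : ℝ) (β : Fin p → ℝ) :
    genLassoCriterion θ.2 (Matrix.of θ.1) D lam β =
      halfSqResidual (β, θ) + lam * ‖WithLp.toLp 1 (D *ᵥ β)‖ := by
  simp [genLassoCriterion, halfSqResidual, EuclideanSpace.norm_sq_eq, Matrix.mulVec, dotProduct]

theorem fderiv_halfSqResidual_apply {n p : ℕ} (β : Fin p → ℝ)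
    (θ v : (Fin n → Fin p → ℝ) × (Fin n → ℝ)) :
    fderiv ℝ (fun θ' => halfSqResidual (β, θ')) θ v =
      (θ.2 - Matrix.of θ.1 *ᵥ β) ⬝ᵥ (v.2 - Matrix.of v.1 *ᵥ β) := by
  have hd : DifferentiableAt ℝ (fun θ' => halfSqResidual (n := n) (β, θ')) θ :=
    ((contDiff_halfSqResidual.differentiable one_ne_zero).comp
      (by fun_prop : Differentiable ℝ fun θ' => (β, θ'))) θ
  rw [← hd.lineDeriv_eq_fderiv]
  refine HasLineDerivAt.lineDeriv ?_
  have hline : (fun t : ℝ => halfSqResidual (β, θ + t • v)) = fun t => 1 / 2 * ∑ i,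
      ((θ.2 - Matrix.of θ.1 *ᵥ β) i + t * (v.2 - Matrix.of v.1 *ᵥ β) i) ^ 2 := by
    funext t
    simp only [halfSqResidual, Matrix.mulVec, dotProduct, Prod.snd_add, Prod.fst_add, Prod.smul_fst,
      Prod.smul_snd, Pi.add_apply, Pi.smul_apply, Pi.sub_apply, smul_eq_mul, Matrix.of_apply,
      add_mul, Finset.sum_add_distrib, mul_assoc, ← Finset.mul_sum]
    congr 2 with i
    ring
  rw [HasLineDerivAt, hline]
  have := (HasDerivAt.fun_sum (u := Finset.univ) fun i _ =>
    (((hasDerivAt_id (0 : ℝ)).mul_const ((v.2 - Matrix.of v.1 *ᵥ β) i)).const_add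
      ((θ.2 - Matrix.of θ.1 *ᵥ β) i)).pow 2).const_mul (1 / 2 : ℝ)
  convert! this using 1
  simp only [dotProduct, Finset.mul_sum]
  refine Finset.sum_congr rfl fun i _ => ?_
  simp
  ring

/-- The derivative of `½ ‖y - X β‖²` in `(X, y)` determines the residual `r = y - X β` and the
rank-one matrix `r βᵀ`, hence `β` itself unless `r = 0`. -/
theorem residual_eq_and_eq_of_fderiv_eq {n p : ℕ} {θ : (Fin n → Fin p → ℝ) × (Fin n → ℝ)}
    {β₁ β₂ : Fin p → ℝ}
    (h : fderiv ℝ (fun θ' => halfSqResidual (β₁, θ')) θ =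
      fderiv ℝ (fun θ' => halfSqResidual (β₂, θ')) θ) :
    Matrix.of θ.1 *ᵥ β₁ = Matrix.of θ.1 *ᵥ β₂ ∧
      (θ.2 - Matrix.of θ.1 *ᵥ β₁ ≠ 0 → β₁ = β₂) := by
  have hv := fun v => congrArg (fun f => f v) h
  simp only [fderiv_halfSqResidual_apply] at hv
  have hr : Matrix.of θ.1 *ᵥ β₁ = Matrix.of θ.1 *ᵥ β₂ := by
    have : θ.2 - Matrix.of θ.1 *ᵥ β₁ = θ.2 - Matrix.of θ.1 *ᵥ β₂ :=
      dotProduct_eq _ _ fun w => by simpa using hv (0, w)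
    simpa using this
  refine ⟨hr, fun hne => ?_⟩
  rw [← hr] at hv
  set r := θ.2 - Matrix.of θ.1 *ᵥ β₁
  -- Perturb the design matrix in the rank-one direction `r (β₁ - β₂)ᵀ`.
  have h1 := hv (Matrix.of.symm (Matrix.vecMulVec r (β₁ - β₂)), 0)
  simp only [Equiv.apply_symm_apply, Matrix.vecMulVec_mulVec, zero_sub, dotProduct_neg,
    neg_inj] at h1
  have h2 : (r ⬝ᵥ r) * ((β₁ - β₂) ⬝ᵥ (β₁ - β₂)) = 0 := by
    rw [dotProduct_sub (β₁ - β₂), mul_sub, sub_eq_zero]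
    simpa [mul_comm] using h1
  rcases mul_eq_zero.1 h2 with h3 | h3
  · exact absurd (dotProduct_self_eq_zero.1 h3) hne
  · exact sub_eq_zero.1 (dotProduct_self_eq_zero.1 h3)

/-! ### Almost sure uniqueness -/

theorem ae_existsUnique_isGenLassoSolution {n p m : ℕ} (D : Matrix (Fin m) (Fin p) ℝ) {lam : ℝ}
    (hlam : 0 < lam) (hD : matrixNullity D ≤ n) :
    ∀ᵐ θ : (Fin n → Fin p → ℝ) × (Fin n → ℝ),
      ∃! β, IsGenLassoSolution θ.2 (Matrix.of θ.1) D lam β := by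
  have hinj : ∀ᵐ θ : (Fin n → Fin p → ℝ) × (Fin n → ℝ),
      ∀ β ∈ LinearMap.ker D.mulVecLin, Matrix.of θ.1 *ᵥ β = 0 → β = 0 :=
    Measure.quasiMeasurePreserving_fst.ae (ae_mulVec_injOn _ hD)
  have : (volume : Measure ((Fin n → Fin p → ℝ) × (Fin n → ℝ))).IsAddHaarMeasure := by
    have : (volume : Measure (Fin n → Fin p → ℝ)).IsAddHaarMeasure :=
      Measure.pi.isAddHaarMeasure _
    exact Measure.prod.instIsAddHaarMeasure _ _
  filter_upwards [hinj, ae_forall_minimizers_fderiv_eq volume contDiff_halfSqResidual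
    (by fun_prop : Continuous fun β => lam * ‖WithLp.toLp 1 (D *ᵥ β)‖)] with θ hX henv
  obtain ⟨β, hβ⟩ := exists_isGenLassoSolution θ.2 (Matrix.of θ.1) D hlam hX
  refine ⟨β, hβ, fun β' hβ' => ?_⟩
  obtain ⟨hr, hne⟩ := residual_eq_and_eq_of_fderiv_eq (henv β' β
    (fun b => by simpa only [genLassoCriterion_eq] using hβ' b)
    (fun b => by simpa only [genLassoCriterion_eq] using hβ b))
  by_cases h0 : θ.2 - Matrix.of θ.1 *ᵥ β' = 0
  · refine sub_eq_zero.1 (hX _ ?_ ?_)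
    · rw [LinearMap.mem_ker, Matrix.mulVecLin_apply, Matrix.mulVec_sub,
        hβ'.mulVec_eq_zero hlam h0, hβ.mulVec_eq_zero hlam (hr ▸ h0), sub_zero]
    · rw [Matrix.mulVec_sub, hr, sub_self]
  · exact hne h0

theorem theorem1 {n p m : ℕ} (D : Matrix (Fin m) (Fin p) ℝ) (lam : ℝ) (hlam : 0 < lam)
    {Ω : Type*} [MeasurableSpace Ω] (P : Measure Ω) [IsProbabilityMeasure P]
    (X : Ω → Matrix (Fin n) (Fin p) ℝ) (y : Ω → Fin n → ℝ)
    (hmeas : AEMeasurable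
      (fun ω => ((fun i j => X ω i j, y ω) : (Fin n → Fin p → ℝ) × (Fin n → ℝ))) P)
    (hac : P.map (fun ω => ((fun i j => X ω i j, y ω) : (Fin n → Fin p → ℝ) × (Fin n → ℝ)))
      ≪ (volume : Measure ((Fin n → Fin p → ℝ) × (Fin n → ℝ))))
    (hdim : p ≤ n ∨ (n < p ∧ matrixNullity D ≤ n)) :
    ∀ᵐ ω ∂P, ∃! β : Fin p → ℝ, IsGenLassoSolution (y ω) (X ω) D lam β := by
  have hD : matrixNullity D ≤ n := by
    rcases hdim with h | h
    · exact ((Submodule.finrank_le _).trans_eq (Module.finrank_fin_fun ℝ)).trans h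
    · exact h.2
  exact ae_of_ae_map hmeas (hac.ae_le (ae_existsUnique_isGenLassoSolution D hlam hD))
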